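/- Let $n\ge 0$, let $S$ be a finite nonempty set, and say that an algorithm (classical or quantum) $(p,q)$-computes $f:\{0,1\}^n\to\{0,1\}$ if on every input $x$ it outputs $1$ with probability at most $p$ when $f(x)=0$, and with probability at least $q$ when $f(x)=1$. A classical probabilistic algorithm with sample space $S$ is a map $A:\{0,1\}^n\times S\to\{0,1\}$, which on input $x$ outputs $A(x,r)$ for a uniformly random $r\in S$. A quantum algorithm that makes $T$ calls to a black box for $A$ starts in a fixed basis state, applies $U_TOU_{T-1}O\cdots OU_1OU_0$, where $O$ is the query gate $|y,r,b\rangle\mapsto|y,r,b\oplus A(y,r)\rangle$ and the unitaries $U_k$ may depend on the input $x$ but not on $A$, and then measures a designated output qubit. Theorem. There is a universal constant $c>0$ such that for all $n$ and $S$ as above and all real $\varepsilon\ge 2^{-|S|}$ the following holds. If a quantum algorithm making $T$ calls to its black box has the property that, whenever the black box is a classical probabilistic algorithm $A:\{0,1\}^n\times S\to\{0,1\}$ that $(0,\tfrac12)$-computes some function $f:\{0,1\}^n\to\{0,1\}$, the quantum algorithm $(0,1-\varepsilon)$-computes this $f$, then $$T\ \ge\ c\,\log(1/\varepsilon).$$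 -/

import Mathlib

noncomputable section

/-- If on input `x` some algorithm outputs `1` with probability `prob x`, then it
`(p, q)`-computes `f : {0,1}ⁿ → {0,1}` when this probability is at most `p` whenever `f x = 0`
and at least `q` whenever `f x = 1`. -/
def PQComputes {n : ℕ} (p q : ℝ) (prob : (Fin n → Bool) → ℝ) (f : (Fin n → Bool) → Bool) :
    Prop :=
  ∀ x, (f x = false → prob x ≤ p) ∧ (f x = true → q ≤ prob x)

/-- A classical probabilistic algorithm `A : {0,1}ⁿ × S → {0,1}`: a deterministic algorithm with
an auxiliary input `r`, which is uniformly distributed over the finite sample space `S`. -/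
abbrev ClassicalAlgorithm (n : ℕ) (S : Type*) := (Fin n → Bool) × S → Bool

/-- `Pr[A(x) = 1]`, the probability being over a uniformly distributed `r ∈ S`. -/
def ClassicalAlgorithm.acceptProb {n : ℕ} {S : Type*} [Fintype S] (A : ClassicalAlgorithm n S)
    (x : Fin n → Bool) : ℝ :=
  ((Finset.univ.filter fun r : S => A (x, r) = true).card : ℝ) / (Fintype.card S : ℝ)

/-- The computational basis states `|(y, r), b, w, o⟩` of a network: a query register
holding `(y, r) ∈ {0,1}ⁿ × S`, the target qubit `b` of the query gate, `m` further work qubits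
`w`, and, rightmost, the output qubit `o`. -/
abbrev BasisState (n : ℕ) (S : Type*) (m : ℕ) :=
  ((Fin n → Bool) × S) × Bool × (Fin m → Bool) × Bool

/-- The action of the query gate on basis states:
`|(y, r), b, w, o⟩ ↦ |(y, r), b ⊕ A(y, r), w, o⟩`. -/
def queryMap {n : ℕ} {S : Type*} (m : ℕ) (A : ClassicalAlgorithm n S) :
    BasisState n S m → BasisState n S m :=
  fun s => (s.1, xor s.2.1 (A s.1), s.2.2)

/-- The query gate `O` for the black box `A`, as a matrix in the computational basis. -/
def queryGate {n : ℕ} {S : Type*} [DecidableEq S] (m : ℕ) (A : ClassicalAlgorithm n S) :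
    Matrix (BasisState n S m) (BasisState n S m) ℂ :=
  Matrix.of fun i j => if i = queryMap m A j then 1 else 0

/-- A quantum algorithm that gets an input `x ∈ {0,1}ⁿ` and a black box for some classical
algorithm `A : {0,1}ⁿ × S → {0,1}`. On input `x` it applies `U_T O U_{T-1} O ⋯ O U_1 O U_0` to a
fixed basis state, where `O` is the query gate of the black box and `U_k = gate x k`. The unitaries
`U_k` may depend arbitrarily on the input `x`, but not on the black box. -/
structure QuantumAlgorithm (n : ℕ) (S : Type*) [Fintype S] [DecidableEq S] where
  /-- the number `T` of queries, that is, of calls to the black box -/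
  queries : ℕ
  /-- the number of additional work qubits -/
  work : ℕ
  /-- the initial basis state -/
  init : BasisState n S work
  /-- the unitaries `U_0, U_1, …` (only `U_0, …, U_T` are used) -/
  gate : (Fin n → Bool) → ℕ → Matrix.unitaryGroup (BasisState n S work) ℂ

namespace QuantumAlgorithm

variable {n : ℕ} {S : Type*} [Fintype S] [DecidableEq S]

/-- The state `U_k O U_{k-1} O ⋯ O U_0 |init⟩` on input `x` with black box `A`, as the vector of
its amplitudes. -/
def state (Q : QuantumAlgorithm n S) (A : ClassicalAlgorithm n S) (x : Fin n → Bool) :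
    ℕ → BasisState n S Q.work → ℂ
  | 0 => (Q.gate x 0).1.mulVec (Pi.single Q.init 1)
  | k + 1 => (Q.gate x (k + 1)).1.mulVec ((queryGate Q.work A).mulVec (Q.state A x k))

/-- The acceptance probability on input `x` with black box `A`: the probability that a measurement
of the output qubit of the final state gives `1`. -/
def acceptProb (Q : QuantumAlgorithm n S) (A : ClassicalAlgorithm n S) (x : Fin n → Bool) : ℝ :=
  ∑ s : BasisState n S Q.work, if s.2.2.2 = true then ‖Q.state A x Q.queries s‖ ^ 2 else 0

/-- Given a black box for any classical algorithm `A` that `(p, q)`-computes some function `f`,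
the quantum algorithm `(p', q')`-computes this `f`. -/
def Amplifies (Q : QuantumAlgorithm n S) (p q p' q' : ℝ) : Prop :=
  ∀ (A : ClassicalAlgorithm n S) (f : (Fin n → Bool) → Bool),
    PQComputes p q A.acceptProb f → PQComputes p' q' (Q.acceptProb A) f

end QuantumAlgorithm

end

/-!
The proof is by the polynomial method. Let `N = |S|` and fix one input `x`. For `X ⊆ S` consider
the classical algorithm that on input `x` accepts exactly the random strings in `X`, and on all
other inputs always rejects (`pointAlgorithm x X`). It is an admissible black box if `X = ∅` or
`2|X| ≥ N`, and the quantum algorithm must accept `x` with probability `0` in the first case and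
at least `1 - ε` in the second.

Each query raises the degree of the amplitudes, as multilinear polynomials in the indicators
`[r ∈ X]`, by at most one (`state_pointAlgorithm_mem`), so that the acceptance probability has
degree at most `2T`. Averaging the rejection probability over all `k`-element sets `X` turns it into
a univariate polynomial `p` in `k` of degree at most `2T` (`exists_polynomial_eq_average`), with
`p(0) = 1` and `|p(k)| ≤ ε` at all integers `k` in `[N/2, N]`.

If `4T ≤ N`, there are `2T + 1` equally spaced integers in `[N/2, N]` whose spacing is of order
`N/T`. Lagrange interpolation at these points bounds `|p(0)|` by `ε` times an exponential in `T`
(`norm_eval_zero_le_of_two_mul_degree_le`), which gives `log(1/ε) ≤ 24T`. If `4T > N`, then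
`ε ≥ 2^(-N)` already yields `log(1/ε) ≤ N < 4T`.
-/

/-! ### Extrapolating a polynomial from integer points -/

open Finset in
theorem prod_erase_abs_sub_eq_factorial_mul (d i : ℕ) (hi : i ≤ d) :
    ∏ j ∈ (range (d + 1)).erase i, |(i : ℝ) - j| = (i.factorial : ℝ) * (d - i).factorial := by
  obtain ⟨e, rfl⟩ := Nat.exists_eq_add_of_le hi
  have hmem : i ∈ range (i + e + 1) := by simp
  have h1 : ∏ j ∈ (range (i + e + 1)).erase i, |(i : ℝ) - j|
      = ∏ j ∈ range (i + 1 + e), if j = i then 1 else |(i : ℝ) - j| := by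
    rw [show i + 1 + e = i + e + 1 by omega, ← mul_prod_erase _ _ hmem, if_pos rfl, one_mul]
    exact prod_congr rfl fun j hj => (if_neg (ne_of_mem_erase hj)).symm
  have h2 : ∏ j ∈ range i, (if j = i then 1 else |(i : ℝ) - j|) = (i.factorial : ℝ) := by
    rw [← prod_range_add_one_eq_factorial, ← prod_range_reflect, Nat.cast_prod]
    refine prod_congr rfl fun j hj => ?_
    have hj' : j < i := mem_range.1 hj
    rw [if_neg (by omega), Nat.cast_sub (by omega), Nat.cast_sub (by omega)]
    push_cast
    rw [abs_of_nonneg] <;> linarith [(Nat.cast_nonneg j : (0 : ℝ) ≤ j)]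
  have h3 : ∏ j ∈ range e, (if i + 1 + j = i then 1 else |(i : ℝ) - (i + 1 + j : ℕ)|)
      = (e.factorial : ℝ) := by
    rw [← prod_range_add_one_eq_factorial, Nat.cast_prod]
    refine prod_congr rfl fun j _ => ?_
    rw [if_neg (by omega), abs_sub_comm]
    push_cast
    rw [abs_of_nonneg] <;> linarith [(Nat.cast_nonneg j : (0 : ℝ) ≤ j)]
  rw [h1, prod_range_add, prod_range_succ, if_pos rfl, mul_one, h2, h3, Nat.add_sub_cancel_left]

open Finset Polynomial in
/-- Lagrange interpolation at `a, a + s, …, a + d s` and evaluation at `0`: the `i`-th basis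
polynomial is there at most `(N / s) ^ d / (i! (d - i)!)` in norm, and these bounds add up to
`(N / s) ^ d 2 ^ d / d!`. -/
theorem norm_eval_zero_le_of_norm_eval_le {p : ℂ[X]} {d a s N : ℕ} {ε : ℝ}
    (hp : p.degree < (d + 1 : ℕ)) (hs : 0 < s) (hN : a + d * s ≤ N)
    (hε : ∀ k : ℕ, a ≤ k → k ≤ N → ‖p.eval (k : ℂ)‖ ≤ ε) :
    ‖p.eval 0‖ ≤ ε * ((N / s : ℝ) ^ d * 2 ^ d / d.factorial) := by
  set v : ℕ → ℂ := fun i => ((a + i * s : ℕ) : ℂ) with hv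
  have hinj : Set.InjOn v (range (d + 1)) := by
    intro i _ j _ hij
    have h : a + i * s = a + j * s := Nat.cast_injective hij
    exact Nat.eq_of_mul_eq_mul_right hs (by omega)
  have hs' : (0 : ℝ) < s := Nat.cast_pos.2 hs
  have hle : ∀ j ∈ range (d + 1), a + j * s ≤ N := fun j hj =>
    le_trans (by gcongr; exact Nat.lt_succ_iff.1 (mem_range.1 hj)) hN
  have hbasis : ∀ i ∈ range (d + 1),
      ‖(Lagrange.basis (range (d + 1)) v i).eval 0‖ ≤
        (N / s : ℝ) ^ d * (d.choose i / d.factorial) := by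
    intro i hi
    have hid : i ≤ d := Nat.lt_succ_iff.1 (mem_range.1 hi)
    have hcard : #((range (d + 1)).erase i) = d := by simp [card_erase_of_mem hi]
    have hfac : ∀ j ∈ (range (d + 1)).erase i,
        ‖(Lagrange.basisDivisor (v i) (v j)).eval 0‖ ≤ (N / s : ℝ) * |(i : ℝ) - j|⁻¹ := by
      intro j hj
      have hvj : ‖v j‖ ≤ N := by
        rw [hv, Complex.norm_natCast]
        exact_mod_cast hle j (mem_of_mem_erase hj)
      have hvij : ‖v i - v j‖ = s * |(i : ℝ) - j| := by
        have : v i - v j = (((s : ℝ) * ((i : ℝ) - j) : ℝ) : ℂ) := by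
          simp only [hv]; push_cast; ring
        rw [this, Complex.norm_real, Real.norm_eq_abs, abs_mul, abs_of_pos hs']
      rw [Lagrange.basisDivisor, eval_mul, eval_C, eval_sub, eval_X, eval_C, zero_sub, norm_mul,
        norm_neg, norm_inv, hvij, mul_inv, div_eq_mul_inv]
      calc (s : ℝ)⁻¹ * |(i : ℝ) - j|⁻¹ * ‖v j‖ ≤ (s : ℝ)⁻¹ * |(i : ℝ) - j|⁻¹ * N := by gcongr
        _ = _ := by ring
    rw [Lagrange.basis, eval_prod, norm_prod]
    refine (prod_le_prod (fun _ _ => norm_nonneg _) hfac).trans_eq ?_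
    rw [prod_mul_distrib, prod_const, hcard, prod_inv_distrib,
      prod_erase_abs_sub_eq_factorial_mul d i hid, Nat.cast_choose ℝ hid]
    have := Nat.factorial_ne_zero d
    field_simp
  rw [Lagrange.eq_interpolate (f := p) (s := range (d + 1)) hinj (by simpa using hp),
    Lagrange.interpolate_apply, eval_finsetSum]
  calc ‖∑ i ∈ range (d + 1), (C (p.eval (v i)) * Lagrange.basis (range (d + 1)) v i).eval 0‖
      ≤ ∑ i ∈ range (d + 1), ε * ((N / s : ℝ) ^ d * (d.choose i / d.factorial)) := by
        refine norm_sum_le_of_le _ fun i hi => ?_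
        rw [eval_mul, eval_C, norm_mul]
        have h := hε (a + i * s) (by omega) (hle i hi)
        exact mul_le_mul h (hbasis i hi) (norm_nonneg _) ((norm_nonneg _).trans h)
    _ = ε * ((N / s : ℝ) ^ d * 2 ^ d / d.factorial) := by
        rw [← mul_sum, ← mul_sum, ← sum_div, ← Nat.cast_sum, Nat.sum_range_choose]
        push_cast; ring

open Polynomial in
/-- A polynomial of degree at most `d ≤ N / 2` that is bounded by `ε` at the integers in
`[N / 2, N]` is bounded by `ε` times an exponential in `d` at `0`. -/
theorem norm_eval_zero_le_of_two_mul_degree_le {p : ℂ[X]} {d N : ℕ} {ε : ℝ}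
    (hp : p.degree < (d + 1 : ℕ)) (hdN : 2 * d ≤ N)
    (hε : ∀ k : ℕ, N ≤ 2 * k → k ≤ N → ‖p.eval (k : ℂ)‖ ≤ ε) :
    ‖p.eval 0‖ ≤ ε * Real.exp (12 * d) := by
  have hε0 : 0 ≤ ε := (norm_nonneg _).trans (hε N (by omega) le_rfl)
  rcases Nat.eq_zero_or_pos d with rfl | hd
  · have := norm_eval_zero_le_of_norm_eval_le (s := 1) (a := N) hp one_pos (by omega)
      fun k h1 h2 => hε k (by omega) h2
    simpa using this
  -- The largest spacing for which `d + 1` nodes fit into `[N - N / 2, N]`; rounding costs at most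
  -- a constant factor, so that `N / s ≤ 6 d`.
  set s := N / 2 / d
  have hs0 : 0 < s := Nat.div_pos (by omega) hd
  have hds : d * s ≤ N / 2 := Nat.mul_div_le _ _
  have hsd : N / 2 < d * s + d := by
    have := Nat.lt_mul_div_succ (N / 2) hd
    rwa [mul_add, mul_one] at this
  have hsd' : d ≤ d * s := Nat.le_mul_of_pos_right d hs0
  have hN6 : N ≤ 6 * d * s := by rw [mul_assoc]; omega
  have hmain := norm_eval_zero_le_of_norm_eval_le (s := s) (a := N - N / 2) hp hs0 (by omega)
      fun k h1 h2 => hε k (by omega) h2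
  refine hmain.trans (mul_le_mul_of_nonneg_left ?_ hε0)
  have hs' : (0 : ℝ) < s := Nat.cast_pos.2 hs0
  have hNs : (N / s : ℝ) ≤ 6 * d := by
    rw [div_le_iff₀ hs']; exact_mod_cast hN6
  calc (N / s : ℝ) ^ d * 2 ^ d / d.factorial
      ≤ (6 * d : ℝ) ^ d * 2 ^ d / d.factorial := by gcongr
    _ = (12 * d : ℝ) ^ d / d.factorial := by rw [← mul_pow]; ring_nf
    _ ≤ Real.exp (12 * d) := Real.pow_div_factorial_le_exp _ (by positivity) d

/-! ### Low-degree functions of a subset -/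

section FunctionsOfSubsets

variable {S : Type*} [DecidableEq S]

/-- The monomial `∏ r ∈ R, [r ∈ X]`, as a function of the set `X`; since the variables are
`0`-`1`-valued, it is the indicator of `R ⊆ X`. -/
def subsetMonomial (R : Finset S) : Finset S → ℂ := fun X => if R ⊆ X then 1 else 0

theorem subsetMonomial_mul (R R' : Finset S) :
    subsetMonomial R * subsetMonomial R' = subsetMonomial (R ∪ R') := by
  funext X
  simp only [subsetMonomial, Pi.mul_apply, Finset.union_subset_iff]
  split_ifs <;> simp_all

/-- The complex functions of a subset `X` of `S` that are multilinear polynomials of degree at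
most `d` in the indicators `[r ∈ X]`. -/
def subsetFunctionsDegreeLE (S : Type*) [DecidableEq S] (d : ℕ) : Submodule ℂ (Finset S → ℂ) :=
  Submodule.span ℂ {F | ∃ R : Finset S, R.card ≤ d ∧ F = subsetMonomial R}

theorem subsetMonomial_mem {R : Finset S} {d : ℕ} (h : R.card ≤ d) :
    subsetMonomial R ∈ subsetFunctionsDegreeLE S d :=
  Submodule.subset_span ⟨R, h, rfl⟩

theorem const_mem_subsetFunctionsDegreeLE (c : ℂ) (d : ℕ) :
    (fun _ => c) ∈ subsetFunctionsDegreeLE S d := by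
  have h : (fun _ : Finset S => c) = c • subsetMonomial (∅ : Finset S) := by
    funext X; simp [subsetMonomial]
  rw [h]
  exact Submodule.smul_mem _ _ (subsetMonomial_mem (by simp))

theorem subsetFunctionsDegreeLE_mono {a b : ℕ} (h : a ≤ b) :
    subsetFunctionsDegreeLE S a ≤ subsetFunctionsDegreeLE S b :=
  Submodule.span_mono fun _ ⟨R, hR, hF⟩ => ⟨R, hR.trans h, hF⟩

theorem mul_mem_subsetFunctionsDegreeLE {a b : ℕ} {F G : Finset S → ℂ}
    (hF : F ∈ subsetFunctionsDegreeLE S a) (hG : G ∈ subsetFunctionsDegreeLE S b) :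
    F * G ∈ subsetFunctionsDegreeLE S (a + b) := by
  have h := Submodule.mul_mem_mul hF hG
  rw [subsetFunctionsDegreeLE, subsetFunctionsDegreeLE, Submodule.span_mul_span] at h
  refine Submodule.span_mono ?_ h
  rintro _ ⟨_, ⟨R, hR, rfl⟩, _, ⟨R', hR', rfl⟩, rfl⟩
  exact ⟨R ∪ R', (Finset.card_union_le _ _).trans (add_le_add hR hR'), subsetMonomial_mul R R'⟩

theorem star_mem_subsetFunctionsDegreeLE {d : ℕ} {F : Finset S → ℂ}
    (hF : F ∈ subsetFunctionsDegreeLE S d) : star F ∈ subsetFunctionsDegreeLE S d := by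
  induction hF using Submodule.span_induction with
  | mem F h =>
    obtain ⟨R, hR, rfl⟩ := h
    have : star (subsetMonomial R) = subsetMonomial R := by
      funext X; simp only [subsetMonomial, Pi.star_apply]; split_ifs <;> simp
    rw [this]
    exact subsetMonomial_mem hR
  | zero => simp
  | add F G _ _ hF hG => rw [star_add]; exact add_mem hF hG
  | smul c F _ hF => rw [star_smul]; exact Submodule.smul_mem _ _ hF

open Finset Polynomial in
/-- Symmetrization: the average over the `k`-element sets of a function of degree at most `d` is a
polynomial in `k` of degree at most `d`. For the monomial of `R`, the average is
`choose (N - |R|) (k - |R|) / choose N k = choose k |R| / choose N |R|`. -/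
theorem exists_polynomial_eq_average [Fintype S] {d : ℕ} {F : Finset S → ℂ}
    (hF : F ∈ subsetFunctionsDegreeLE S d) :
    ∃ p : ℂ[X], p.degree < (d + 1 : ℕ) ∧ ∀ k ≤ Fintype.card S,
      p.eval (k : ℂ) = (∑ X ∈ powersetCard k univ, F X) / ((Fintype.card S).choose k : ℂ) := by
  induction hF using Submodule.span_induction with
  | mem F h =>
    obtain ⟨R, hR, rfl⟩ := h
    set N := Fintype.card S with hN
    have hRN : #R ≤ N := card_le_univ R
    have hc : (N.choose #R : ℂ) ≠ 0 := Nat.cast_ne_zero.2 (Nat.choose_pos hRN).ne'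
    have hf : ((#R).factorial : ℂ) ≠ 0 := Nat.cast_ne_zero.2 (Nat.factorial_ne_zero _)
    refine ⟨C (((#R).factorial : ℂ) * N.choose #R)⁻¹ * descPochhammer ℂ #R, ?_, fun k hk => ?_⟩
    · rw [degree_C_mul (inv_ne_zero (mul_ne_zero hf hc)),
        degree_eq_natDegree (monic_descPochhammer ℂ _).ne_zero, descPochhammer_natDegree]
      exact_mod_cast Nat.lt_succ_of_le hR
    · have hk' : (N.choose k : ℂ) ≠ 0 := Nat.cast_ne_zero.2 (Nat.choose_pos hk).ne'
      rw [eval_mul, eval_C, descPochhammer_eval_eq_descFactorial,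
        Nat.descFactorial_eq_factorial_mul_choose]
      simp only [subsetMonomial, sum_boole]
      rw [inv_mul_eq_div, div_eq_div_iff (mul_ne_zero hf hc) hk']
      rcases le_or_gt #R k with hRk | hRk
      · rw [card_filter_powersetCard_subset R univ k (subset_univ R) hRk, card_univ, ← hN]
        have := Nat.choose_mul (n := N) hRk
        push_cast
        have h2 : (N.choose k : ℂ) * k.choose #R = N.choose #R * (N - #R).choose (k - #R) := by
          exact_mod_cast this
        linear_combination ((#R).factorial : ℂ) * h2
      · have h0 : {X ∈ powersetCard k (univ : Finset S) | R ⊆ X} = ∅ := by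
          refine filter_eq_empty_iff.2 fun X hX hRX => ?_
          have := card_le_card hRX
          rw [(mem_powersetCard.1 hX).2] at this
          omega
        rw [h0, Nat.choose_eq_zero_of_lt hRk]
        simp
  | zero => exact ⟨0, by simp, by simp⟩
  | add F G _ _ hF hG =>
    obtain ⟨p, hp, hpF⟩ := hF
    obtain ⟨q, hq, hqG⟩ := hG
    refine ⟨p + q, (degree_add_le _ _).trans_lt (max_lt hp hq), fun k hk => ?_⟩
    rw [eval_add, hpF k hk, hqG k hk, ← add_div, ← sum_add_distrib]
    rfl
  | smul c F _ hF =>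
    obtain ⟨p, hp, hpF⟩ := hF
    refine ⟨c • p, (degree_smul_le _ _).trans_lt hp, fun k hk => ?_⟩
    rw [eval_smul, hpF k hk, smul_eq_mul, mul_div_assoc', mul_sum]
    rfl

end FunctionsOfSubsets

/-! ### Quantum algorithms preserve the norm -/

section QueryGate

variable {n : ℕ} {S : Type*}

theorem queryMap_involutive (m : ℕ) (A : ClassicalAlgorithm n S) :
    Function.Involutive (queryMap m A) := by
  rintro ⟨z, b, w⟩
  simp [queryMap]

theorem queryGate_mulVec_apply [Fintype S] [DecidableEq S] (m : ℕ) (A : ClassicalAlgorithm n S)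
    (v : BasisState n S m → ℂ) (i : BasisState n S m) :
    (queryGate m A).mulVec v i = v (queryMap m A i) := by
  have h : ∀ j : BasisState n S m, (i = queryMap m A j) ↔ (queryMap m A i = j) := fun j =>
    ⟨fun h => h ▸ queryMap_involutive m A j, fun h => h ▸ (queryMap_involutive m A i).symm⟩
  simp [Matrix.mulVec, dotProduct, queryGate, h]

end QueryGate

theorem sum_norm_sq_mulVec_of_mem_unitaryGroup {ι : Type*} [Fintype ι] [DecidableEq ι]
    {U : Matrix ι ι ℂ} (hU : U ∈ Matrix.unitaryGroup ι ℂ) (v : ι → ℂ) :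
    ∑ i, ‖U.mulVec v i‖ ^ 2 = ∑ i, ‖v i‖ ^ 2 := by
  have key : ∀ w : ι → ℂ, ((∑ i, ‖w i‖ ^ 2 : ℝ) : ℂ) = star w ⬝ᵥ w := fun w => by
    simp [dotProduct, Complex.conj_mul']
  apply Complex.ofReal_injective
  rw [key, key, Matrix.star_mulVec, Matrix.dotProduct_mulVec, Matrix.vecMul_vecMul,
    ← Matrix.star_eq_conjTranspose, Matrix.mem_unitaryGroup_iff'.1 hU, Matrix.vecMul_one]

namespace QuantumAlgorithm

variable {n : ℕ} {S : Type*} [Fintype S] [DecidableEq S]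

theorem sum_norm_sq_state (Q : QuantumAlgorithm n S) (A : ClassicalAlgorithm n S)
    (x : Fin n → Bool) (k : ℕ) : ∑ s, ‖Q.state A x k s‖ ^ 2 = 1 := by
  induction k with
  | zero =>
    rw [state, sum_norm_sq_mulVec_of_mem_unitaryGroup (Q.gate x 0).2]
    simp [Pi.single_apply, apply_ite (fun z : ℂ => ‖z‖ ^ 2)]
  | succ k ih =>
    rw [state, sum_norm_sq_mulVec_of_mem_unitaryGroup (Q.gate x (k + 1)).2, ← ih]
    simp only [queryGate_mulVec_apply]
    exact (queryMap_involutive Q.work A).bijective.sum_comp fun s => ‖Q.state A x k s‖ ^ 2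

theorem acceptProb_nonneg (Q : QuantumAlgorithm n S) (A : ClassicalAlgorithm n S)
    (x : Fin n → Bool) : 0 ≤ Q.acceptProb A x :=
  Finset.sum_nonneg fun s _ => by split_ifs <;> positivity

theorem acceptProb_le_one (Q : QuantumAlgorithm n S) (A : ClassicalAlgorithm n S)
    (x : Fin n → Bool) : Q.acceptProb A x ≤ 1 := by
  rw [← Q.sum_norm_sq_state A x Q.queries]
  exact Finset.sum_le_sum fun s _ => by split_ifs <;> first | rfl | positivity

end QuantumAlgorithm

/-! ### Black boxes supported on one input -/

/-- The classical algorithm that on input `x` accepts exactly the random strings in `X`, and that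
rejects every other input. -/
def pointAlgorithm {n : ℕ} {S : Type*} [DecidableEq S] (x : Fin n → Bool) (X : Finset S) :
    ClassicalAlgorithm n S :=
  fun z => decide (z.1 = x ∧ z.2 ∈ X)

section PointAlgorithm

variable {n : ℕ} {S : Type*} [Fintype S] [DecidableEq S]

theorem acceptProb_pointAlgorithm (x y : Fin n → Bool) (X : Finset S) :
    (pointAlgorithm x X).acceptProb y = if y = x then (X.card : ℝ) / Fintype.card S else 0 := by
  by_cases h : y = x <;> simp [ClassicalAlgorithm.acceptProb, pointAlgorithm, h]

theorem pqComputes_pointAlgorithm_empty (x : Fin n → Bool) :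
    PQComputes 0 (1 / 2) (pointAlgorithm x (∅ : Finset S)).acceptProb fun _ => false := by
  intro y
  simp [acceptProb_pointAlgorithm]

theorem pqComputes_pointAlgorithm [Nonempty S] (x : Fin n → Bool) {X : Finset S}
    (hX : Fintype.card S ≤ 2 * X.card) :
    PQComputes 0 (1 / 2) (pointAlgorithm x X).acceptProb fun y => decide (y = x) := by
  intro y
  have hN : (0 : ℝ) < Fintype.card S := Nat.cast_pos.2 Fintype.card_pos
  have hX' : (Fintype.card S : ℝ) ≤ 2 * X.card := by exact_mod_cast hX
  by_cases h : y = x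
  · simp only [acceptProb_pointAlgorithm, h, decide_true, if_true]
    refine ⟨by simp, fun _ => ?_⟩
    rw [le_div_iff₀ hN]
    linarith
  · simp [acceptProb_pointAlgorithm, h]

/-- After `k` queries the amplitudes are polynomials of degree at most `k` in the black box. -/
theorem state_pointAlgorithm_mem (Q : QuantumAlgorithm n S) (x : Fin n → Bool) (k : ℕ)
    (s : BasisState n S Q.work) :
    (fun X => Q.state (pointAlgorithm x X) x k s) ∈ subsetFunctionsDegreeLE S k := by
  induction k generalizing s with
  | zero => exact const_mem_subsetFunctionsDegreeLE _ _
  | succ k ih =>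
    have hquery : ∀ t : BasisState n S Q.work,
        (fun X => Q.state (pointAlgorithm x X) x k (queryMap Q.work (pointAlgorithm x X) t)) ∈
          subsetFunctionsDegreeLE S (k + 1) := by
      rintro ⟨⟨y, r⟩, b, w⟩
      by_cases hy : y = x
      -- With `a = [r ∈ X]`, the new amplitude is `α + (α' - α) a`, where `α` and `α'` are the old
      -- amplitudes at `b` and at its negation.
      · have hsplit : (fun X => Q.state (pointAlgorithm x X) x k
              (queryMap Q.work (pointAlgorithm x X) ((y, r), b, w))) =
            (fun X => Q.state (pointAlgorithm x X) x k ((y, r), b, w)) +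
            ((fun X => Q.state (pointAlgorithm x X) x k ((y, r), !b, w)) -
              fun X => Q.state (pointAlgorithm x X) x k ((y, r), b, w)) * subsetMonomial {r} := by
          funext X
          by_cases hr : r ∈ X <;> simp [queryMap, pointAlgorithm, subsetMonomial, hy, hr]
        rw [hsplit]
        exact add_mem (subsetFunctionsDegreeLE_mono (Nat.le_succ k) (ih _))
          (mul_mem_subsetFunctionsDegreeLE (sub_mem (ih _) (ih _)) (subsetMonomial_mem (by simp)))
      · have hfix : ∀ X : Finset S,
            queryMap Q.work (pointAlgorithm x X) ((y, r), b, w) = ((y, r), b, w) := fun X => by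
          simp [queryMap, pointAlgorithm, hy]
        simp only [hfix]
        exact subsetFunctionsDegreeLE_mono (Nat.le_succ k) (ih _)
    have hsum : (fun X => Q.state (pointAlgorithm x X) x (k + 1) s) =
        ∑ t, (Q.gate x (k + 1)).1 s t • fun X =>
          Q.state (pointAlgorithm x X) x k (queryMap Q.work (pointAlgorithm x X) t) := by
      funext X
      simp only [QuantumAlgorithm.state, Matrix.mulVec, dotProduct, Finset.sum_apply,
        Pi.smul_apply, smul_eq_mul]
      exact Finset.sum_congr rfl fun t _ => congrArg _ (queryGate_mulVec_apply _ _ _ t)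
    rw [hsum]
    exact sum_mem fun t _ => Submodule.smul_mem _ _ (hquery t)

theorem acceptProb_pointAlgorithm_mem (Q : QuantumAlgorithm n S) (x : Fin n → Bool) :
    (fun X => (Q.acceptProb (pointAlgorithm x X) x : ℂ)) ∈
      subsetFunctionsDegreeLE S (2 * Q.queries) := by
  have hsum : (fun X => (Q.acceptProb (pointAlgorithm x X) x : ℂ)) =
      ∑ s : BasisState n S Q.work, if s.2.2.2 = true then
        star (fun X => Q.state (pointAlgorithm x X) x Q.queries s) *
          (fun X => Q.state (pointAlgorithm x X) x Q.queries s) else 0 := by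
    funext X
    simp only [QuantumAlgorithm.acceptProb, Complex.ofReal_sum, Finset.sum_apply]
    refine Finset.sum_congr rfl fun s _ => ?_
    split_ifs <;> simp [Complex.conj_mul']
  rw [hsum, two_mul]
  refine sum_mem fun s _ => ?_
  split_ifs
  · exact mul_mem_subsetFunctionsDegreeLE
      (star_mem_subsetFunctionsDegreeLE (state_pointAlgorithm_mem Q x _ s))
      (state_pointAlgorithm_mem Q x _ s)
  · exact zero_mem _

end PointAlgorithm

/-! ### The lower bound -/

open Finset in
/-- The trade-off between the error and the number of queries when the latter is at most `|S| / 4`.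
The polynomial to be extrapolated is the average rejection probability. -/
theorem QuantumAlgorithm.Amplifies.one_le_mul_exp {n : ℕ} {S : Type*} [Fintype S] [DecidableEq S]
    [Nonempty S] {ε : ℝ} {Q : QuantumAlgorithm n S} (hQ : Q.Amplifies 0 (1 / 2) 0 (1 - ε))
    (hT : 4 * Q.queries ≤ Fintype.card S) : 1 ≤ ε * Real.exp (24 * Q.queries) := by
  set x : Fin n → Bool := fun _ => false
  have hone := const_mem_subsetFunctionsDegreeLE (S := S) 1 (2 * Q.queries)
  obtain ⟨p, hp, hpavg⟩ := exists_polynomial_eq_average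
    (sub_mem hone (acceptProb_pointAlgorithm_mem Q x))
  have hempty : Q.acceptProb (pointAlgorithm x ∅) x = 0 :=
    le_antisymm ((hQ _ _ (pqComputes_pointAlgorithm_empty x) x).1 rfl) (Q.acceptProb_nonneg _ _)
  have hp0 : p.eval 0 = 1 := by
    have := hpavg 0 (Nat.zero_le _)
    simpa [hempty] using this
  have hsmall : ∀ k : ℕ, Fintype.card S ≤ 2 * k → k ≤ Fintype.card S → ‖p.eval (k : ℂ)‖ ≤ ε := by
    intro k hk hkN
    have hc : (0 : ℝ) < (Fintype.card S).choose k := Nat.cast_pos.2 (Nat.choose_pos hkN)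
    rw [hpavg k hkN, norm_div, Complex.norm_natCast, div_le_iff₀ hc]
    have hle : ∀ X ∈ powersetCard k (univ : Finset S),
        ‖(1 : ℂ) - (Q.acceptProb (pointAlgorithm x X) x : ℂ)‖ ≤ ε := by
      intro X hX
      have hX' : Fintype.card S ≤ 2 * #X := by rwa [(mem_powersetCard.1 hX).2]
      have h1 := (hQ _ _ (pqComputes_pointAlgorithm x hX') x).2 (by simp)
      have h2 := Q.acceptProb_le_one (pointAlgorithm x X) x
      rw [← Complex.ofReal_one, ← Complex.ofReal_sub, Complex.norm_real,
        Real.norm_eq_abs, abs_of_nonneg (by linarith)]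
      linarith
    refine (norm_sum_le_of_le _ hle).trans_eq ?_
    rw [sum_const, card_powersetCard, card_univ, nsmul_eq_mul, mul_comm]
  have := norm_eval_zero_le_of_two_mul_degree_le hp (by omega) hsmall
  rw [hp0, norm_one] at this
  convert! this using 3
  push_cast
  ring

theorem theorem5 :
    ∃ c : ℝ, 0 < c ∧
      ∀ (n : ℕ) (S : Type*) [Fintype S] [DecidableEq S] [Nonempty S] (ε : ℝ),
        (2 : ℝ) ^ (-(Fintype.card S : ℝ)) ≤ ε →
        ∀ Q : QuantumAlgorithm n S, Q.Amplifies 0 (1 / 2) 0 (1 - ε) →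
          c * Real.log (1 / ε) ≤ (Q.queries : ℝ) := by
  refine ⟨1 / 24, by norm_num, fun n S _ _ _ ε hε Q hQ => ?_⟩
  have hε0 : 0 < ε := lt_of_lt_of_le (by positivity) hε
  suffices h : -Real.log ε ≤ 24 * Q.queries by
    rw [one_div ε, Real.log_inv]
    linarith
  rcases le_or_gt (4 * Q.queries) (Fintype.card S) with hT | hT
  · have h := Real.log_le_log one_pos (hQ.one_le_mul_exp hT)
    rw [Real.log_one, Real.log_mul hε0.ne' (Real.exp_pos _).ne', Real.log_exp] at h
    linarith
  · have h := Real.log_le_log (by positivity) hε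
    rw [Real.log_rpow two_pos] at h
    have hT' : (Fintype.card S : ℝ) ≤ 4 * Q.queries := by exact_mod_cast hT.le
    have hlog : Real.log 2 ≤ 1 := by linarith [Real.log_two_lt_d9]
    nlinarith [(Nat.cast_nonneg (Fintype.card S) : (0 : ℝ) ≤ Fintype.card S)]
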